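/- Let $p$ be a normalized complex polynomial, i.e. $p(z)=z^d+a_{d-1}z^{d-1}+\dots+a_0$ is monic of degree $d\ge 2$ with centroid at the origin ($a_{d-1}=0$). Let $$C_p(z)=z-\Bigl(1+\tfrac12 L_p(z)\Bigr)\frac{p(z)}{p'(z)},\qquad L_p(z)=\frac{p(z)\,p''(z)}{p'(z)^2},$$ be Chebyshev's method applied to $p$, regarded as a rational map of $\widehat{\mathbb C}=\mathbb C\cup\{\infty\}$. For a non-constant rational map $R$ let $\mathcal F(R)$ be the largest open subset of $\widehat{\mathbb C}$ on which the iterates $\{R^n\}_{n>0}$ are equicontinuous for the chordal metric, let $\mathcal J(R)=\widehat{\mathbb C}\setminus\mathcal F(R)$ be its Julia set, and let $\Sigma R$ be the set of all maps $\sigma(z)=az+b$ with $a,b\in\mathbb C$, $|a|=1$ (extended by $\sigma(\infty)=\infty$), such that $\sigma(\mathcal J(R))=\mathcal J(R)$. Then $$\Sigma p\subseteq \Sigma C_p .$$ Moreover, whenever $p(z)=z^{\alpha}p_0(z^{\beta})$ with integers $\alpha\ge 0$, $\beta\ge 1$ and a polynomial $p_0$, the map $C_p$ commutes on $\widehat{\mathbb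 C}$ with each rotation $z\mapsto\lambda z$ with $\lambda^\beta=1$. -/

import Mathlib

open Polynomial Topology

/-- The chordal distance on the extended complex plane `OnePoint ℂ`. -/
noncomputable def chordalDist : OnePoint ℂ → OnePoint ℂ → ℝ
  | none, none => 0
  | none, some w => 2 / √(1 + ‖w‖ ^ 2)
  | some z, none => 2 / √(1 + ‖z‖ ^ 2)
  | some z, some w => 2 * ‖z - w‖ / (√(1 + ‖z‖ ^ 2) * √(1 + ‖w‖ ^ 2))

open Classical in
/-- The self-map of the extended complex plane given by a rational function. The fraction
`R.num / R.denom` is in lowest terms and `R.denom` is monic, so a zero of the denominator is a pole,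
and the value at infinity is the limit of `R` there: infinity when `R.num` has the larger degree,
and otherwise the coefficient of `R.num` in the degree of `R.denom`. -/
noncomputable def ratMap (R : RatFunc ℂ) : OnePoint ℂ → OnePoint ℂ
  | none =>
      if R.denom.natDegree < R.num.natDegree then OnePoint.infty
      else ((R.num.coeff R.denom.natDegree : ℂ) : OnePoint ℂ)
  | some z =>
      if R.denom.eval z = 0 then OnePoint.infty
      else ((R.num.eval z / R.denom.eval z : ℂ) : OnePoint ℂ)

/-- The iterates `f^n`, `n > 0`, are equicontinuous at `z` in the chordal metric. -/
def IteratesEquicontinuousAt (f : OnePoint ℂ → OnePoint ℂ) (z : OnePoint ℂ) : Prop :=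
  ∀ ε : ℝ, 0 < ε → ∀ᶠ w in 𝓝 z, ∀ n : ℕ, 0 < n → chordalDist (f^[n] w) (f^[n] z) < ε

/-- The Fatou set: the largest open set at each point of which the iterates are equicontinuous. -/
def fatouSet (f : OnePoint ℂ → OnePoint ℂ) : Set (OnePoint ℂ) :=
  ⋃₀ {U | IsOpen U ∧ ∀ z ∈ U, IteratesEquicontinuousAt f z}

/-- The Julia set: the complement of the Fatou set in the extended complex plane. -/
def juliaSet (f : OnePoint ℂ → OnePoint ℂ) : Set (OnePoint ℂ) :=
  (fatouSet f)ᶜ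

/-- The map `z ↦ a z + b` on the extended complex plane, fixing infinity. -/
noncomputable def affineSphere (a b : ℂ) : OnePoint ℂ → OnePoint ℂ :=
  OnePoint.map fun z => a * z + b

/-- The symmetry group `Σ R`: all maps `z ↦ a z + b` with `|a| = 1` that map the Julia set
of `R` onto itself. -/
def juliaSymmetries (R : RatFunc ℂ) : Set (OnePoint ℂ → OnePoint ℂ) :=
  {σ | ∃ a b : ℂ, ‖a‖ = 1 ∧ σ = affineSphere a b ∧
    σ '' juliaSet (ratMap R) = juliaSet (ratMap R)}

/-- A polynomial regarded as a rational function. -/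
noncomputable def polyRat (p : ℂ[X]) : RatFunc ℂ :=
  algebraMap ℂ[X] (RatFunc ℂ) p

/-- The centroid `-a_{d-1} / (d a_d)` of a polynomial of degree `d ≥ 1`. -/
noncomputable def centroid (p : ℂ[X]) : ℂ :=
  -p.coeff (p.natDegree - 1) / (p.natDegree * p.leadingCoeff)

/-- Normalized polynomials: of degree at least two, monic, with centroid at the origin. -/
def IsNormalizedPoly (p : ℂ[X]) : Prop :=
  2 ≤ p.natDegree ∧ p.Monic ∧ centroid p = 0

/-- The rational function `L_p = p p'' / (p')^2`. -/
noncomputable def chebyshevL (p : ℂ[X]) : RatFunc ℂ :=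
  polyRat p * polyRat (derivative (derivative p)) / polyRat (derivative p) ^ 2

/-- Chebyshev's method `C_p = z - (1 + L_p / 2) p / p'`. -/
noncomputable def chebyshevMethod (p : ℂ[X]) : RatFunc ℂ :=
  RatFunc.X - (1 + 1 / 2 * chebyshevL p) * (polyRat p / polyRat (derivative p))

/-! Let `J` be the finite part of the Julia set of `p`: compact, nonempty and completely invariant.
Suppose σ(z) = az + b with |a| = 1 preserves it. If a = 1, boundedness forces b = 0. Otherwise σ
rotates about a point c. Take `v = w₀ - c` of maximal modulus with `w₀ ∈ J`, and put h = a⁻ᵈ(p∘σ -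
c) - (p - c), of degree below d. Then |p - c + h| ≤ |v| on `J`. The sum of h over a fibre of p does
not depend on the fibre (Newton's identities). Averaging the bound over the fibres above c + aᵏv,
for all k, shows that this sum is 0. Strict convexity of the disc then makes h vanish on the whole
fibre above each extremal point. If v ≠ 0, two such fibres already force h = 0, hence p∘σ - c = aᵈ(p
- c), and the centroid condition gives b = 0. If v = 0, then p = zᵈ. So p(az) = aᵈp(z) in every case
(`rotation_of_invariant`). This relation makes C_p commute with the rotation
(`chebyshevMethod_commute_rotation`), which is a chordal isometry and so preserves the Julia set of
C_p. The second claim uses the same commutation lemma. -/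

/-! ### Power sums over the fibres of a polynomial -/

theorem Multiset.exists_fin_map_univ {α : Type*} (s : Multiset α) :
    ∃ v : Fin (Multiset.card s) → α, (Finset.univ : Finset (Fin (Multiset.card s))).val.map v = s := by
  obtain ⟨l, rfl⟩ := Quot.exists_rep s
  exact ⟨l.get, (Fin.univ_val_map l.get).trans (congrArg _ (List.ofFn_get l))⟩

/-- The Newton recursion for power sums, for multisets. -/
theorem Multiset.sum_map_pow_eq_esymm (s : Multiset ℂ) (k : ℕ) (hk : 0 < k) :
    (s.map (· ^ k)).sum = (-1) ^ (k + 1) * k * s.esymm k -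
      ∑ a ∈ Finset.HasAntidiagonal.antidiagonal k with a.1 ∈ Set.Ioo 0 k,
        (-1) ^ a.1 * s.esymm a.1 * (s.map (· ^ a.2)).sum := by
  obtain ⟨v, hv⟩ := s.exists_fin_map_univ
  have hps : ∀ j, MvPolynomial.aeval v (MvPolynomial.psum (Fin (Multiset.card s)) ℂ j)
      = (s.map (· ^ j)).sum := by
    intro j
    simp only [MvPolynomial.psum, map_sum, map_pow, MvPolynomial.aeval_X]
    conv_rhs => rw [← hv]
    rw [Multiset.map_map]
    rfl
  have hes : ∀ j, MvPolynomial.aeval v (MvPolynomial.esymm (Fin (Multiset.card s)) ℂ j)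
      = s.esymm j := by
    intro j
    rw [MvPolynomial.aeval_esymm_eq_multiset_esymm, hv]
  have := congrArg (MvPolynomial.aeval v)
    (MvPolynomial.psum_eq_mul_esymm_sub_sum (Fin (Multiset.card s)) ℂ k hk)
  simpa only [map_sub, map_mul, map_sum, map_pow, map_neg, map_one, map_natCast, hps, hes] using this

theorem Multiset.sum_map_pow_congr {s t : Multiset ℂ} (hc : Multiset.card s = Multiset.card t) {d : ℕ}
    (h : ∀ k < d, s.esymm k = t.esymm k) (k : ℕ) (hk : k < d) :
    (s.map (· ^ k)).sum = (t.map (· ^ k)).sum := by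
  induction k using Nat.strong_induction_on with
  | _ k ih =>
    rcases Nat.eq_zero_or_pos k with rfl | hpos
    · simp [hc]
    · rw [s.sum_map_pow_eq_esymm k hpos, t.sum_map_pow_eq_esymm k hpos, h k hk]
      congr 1
      refine Finset.sum_congr rfl fun a ha => ?_
      simp only [Finset.mem_filter, Finset.HasAntidiagonal.mem_antidiagonal, Set.mem_Ioo] at ha
      rw [h a.1 (by omega), ih a.2 (by omega) (by omega)]

theorem Polynomial.Monic.sub_C_of_natDegree_pos {p : ℂ[X]} (hp : p.Monic) (hd : 0 < p.natDegree)
    (w : ℂ) : (p - C w).Monic :=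
  hp.sub_of_left (degree_C_le.trans_lt (natDegree_pos_iff_degree_pos.1 hd))

theorem Polynomial.card_fibre (p : ℂ[X]) (w : ℂ) :
    Multiset.card (p - C w).roots = p.natDegree := by
  rw [splits_iff_card_roots.1 (IsAlgClosed.splits (p - C w)), natDegree_sub_C]

/-- Only the constant coefficient of p - w depends on w, so the fibres share all elementary
symmetric functions but the last. -/
theorem Polynomial.esymm_roots_sub_C {p : ℂ[X]} (hp : p.Monic) (hd : 0 < p.natDegree) (w : ℂ)
    {k : ℕ} (hk : k < p.natDegree) :
    (p - C w).roots.esymm k = (-1) ^ k * p.coeff (p.natDegree - k) := by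
  have h := coeff_eq_esymm_roots_of_card (p := p - C w)
    (by rw [card_fibre, natDegree_sub_C]) (k := p.natDegree - k)
    (by rw [natDegree_sub_C]; omega)
  rw [natDegree_sub_C, (hp.sub_C_of_natDegree_pos hd w).leadingCoeff,
    show p.natDegree - (p.natDegree - k) = k by omega, coeff_sub, coeff_C,
    if_neg (by omega)] at h
  rw [sub_zero] at h
  rw [h, one_mul, ← mul_assoc, ← mul_pow]
  simp

/-- The sum of a polynomial of degree less than `deg p` over a fibre of `p` does not depend on
the fibre. -/
theorem Polynomial.sum_fibre_eq {p h : ℂ[X]} (hp : p.Monic) (hh : h.natDegree < p.natDegree)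
    (w w' : ℂ) :
    ((p - C w).roots.map h.eval).sum = ((p - C w').roots.map h.eval).sum := by
  have hd : 0 < p.natDegree := by omega
  have key : ∀ s : Multiset ℂ, (s.map h.eval).sum =
      ∑ k ∈ Finset.range p.natDegree, h.coeff k * (s.map (· ^ k)).sum := by
    intro s
    rw [Multiset.map_congr rfl fun z _ => eval_eq_sum_range' hh z, Multiset.sum_map_sum]
    exact Finset.sum_congr rfl fun k _ => Multiset.sum_map_mul_left
  rw [key, key]
  refine Finset.sum_congr rfl fun k hk => ?_
  rw [Multiset.sum_map_pow_congr (t := (p - C w').roots) (d := p.natDegree)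
    (by rw [card_fibre, card_fibre])
    (fun j hj => by rw [esymm_roots_sub_C hp hd w hj, esymm_roots_sub_C hp hd w' hj]) k
    (Finset.mem_range.1 hk)]

/-- A root of p - w of multiplicity m is a root of p' of multiplicity m - 1; the zero of h supplies
the missing factor. -/
theorem Polynomial.sub_C_dvd_mul_derivative {p h : ℂ[X]} (hp : 0 < p.natDegree) (w : ℂ)
    (hh : ∀ z, p.eval z = w → h.eval z = 0) : p - C w ∣ h * derivative p := by
  rcases eq_or_ne h 0 with rfl | h0
  · simp
  have hne : p - C w ≠ 0 := fun e => by
    have := natDegree_sub_C (p := p) (a := w); rw [e] at this; simp at this; omega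
  have hd : derivative p ≠ 0 := fun e => by
    have := derivative_eq_zero.1 e; omega
  refine (IsAlgClosed.splits _).dvd_of_roots_le_roots hne ?_
  rw [Multiset.le_iff_count]
  intro z
  rw [count_roots, count_roots]
  by_cases hz : (p - C w).IsRoot z
  · rw [rootMultiplicity_mul (mul_ne_zero h0 hd)]
    have h1 := derivative_rootMultiplicity_of_root hz
    rw [derivative_sub, derivative_C, sub_zero] at h1
    have h2 : 0 < h.rootMultiplicity z := (rootMultiplicity_pos h0).2
      (hh z (by simpa [sub_eq_zero] using hz))
    omega
  · rw [rootMultiplicity_eq_zero hz]; exact Nat.zero_le _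

/-- A polynomial of degree less than `deg p` that vanishes on two fibres of `p` is zero. -/
theorem Polynomial.eq_zero_of_two_fibres {p h : ℂ[X]} (hh : h.natDegree < p.natDegree)
    {w₁ w₂ : ℂ} (hw : w₁ ≠ w₂) (h₁ : ∀ z, p.eval z = w₁ → h.eval z = 0)
    (h₂ : ∀ z, p.eval z = w₂ → h.eval z = 0) : h = 0 := by
  have hp : 0 < p.natDegree := by omega
  have hcop : IsCoprime (p - C w₁) (p - C w₂) := by
    refine ⟨C ((w₂ - w₁)⁻¹), -C ((w₂ - w₁)⁻¹), ?_⟩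
    have : C ((w₂ - w₁)⁻¹) * (C w₂ - C w₁) = (1 : ℂ[X]) := by
      rw [← C_sub, ← C_mul, inv_mul_cancel₀ (sub_ne_zero.2 hw.symm), C_1]
    linear_combination this
  have hdvd := hcop.mul_dvd (sub_C_dvd_mul_derivative hp w₁ h₁) (sub_C_dvd_mul_derivative hp w₂ h₂)
  have hd : derivative p ≠ 0 := fun e => by
    have := derivative_eq_zero.1 e; omega
  by_contra h0
  -- The divisor (p - w₁)(p - w₂) has degree 2d, while h p' has degree at most 2d - 2.
  have h3 := natDegree_le_of_dvd hdvd (mul_ne_zero h0 hd)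
  have hn : ∀ w, p - C w ≠ 0 := fun w e => by
    have := natDegree_sub_C (p := p) (a := w); rw [e] at this; simp at this; omega
  rw [natDegree_mul (hn _) (hn _), natDegree_mul h0 hd, natDegree_sub_C, natDegree_sub_C] at h3
  have := natDegree_derivative_lt (p := p) (by omega)
  omega

/-! ### Two averaging arguments in a disc -/

/-- Squaring the bound gives |h(z)|² ≤ -2 Re(v̄ h(z)). The right sides are nonnegative and add up to
0, so each vanishes. -/
theorem eq_zero_of_norm_add_le_of_sum_eq_zero (s : Multiset ℂ) (h : ℂ → ℂ) (v : ℂ)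
    (hs : (s.map h).sum = 0) (hv : ∀ z ∈ s, ‖v + h z‖ ≤ ‖v‖) : ∀ z ∈ s, h z = 0 := by
  have hre : ((s.map h).map fun x => 2 * (v.re * x.re + v.im * x.im)).sum = 0 := by
    let L : ℂ →+ ℝ :=
      { toFun := fun x => 2 * (v.re * x.re + v.im * x.im)
        map_zero' := by simp
        map_add' := fun x y => by simp only [Complex.add_re, Complex.add_im]; ring }
    have := AddMonoidHom.map_multiset_sum L (s.map h)
    rw [hs, map_zero] at this
    exact this.symm
  rw [Multiset.map_map] at hre
  have hle : ∀ z ∈ s, 0 ≤ -(2 * (v.re * (h z).re + v.im * (h z).im)) - ‖h z‖ ^ 2 := by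
    intro z hz
    have h1 := pow_le_pow_left₀ (norm_nonneg _) (hv z hz) 2
    rw [Complex.sq_norm, Complex.sq_norm, Complex.normSq_apply, Complex.normSq_apply,
      Complex.add_re, Complex.add_im] at h1
    rw [Complex.sq_norm, Complex.normSq_apply]
    linarith
  intro z hz
  have hnn : ∀ x ∈ s.map (fun z => -(2 * (v.re * (h z).re + v.im * (h z).im))), 0 ≤ x := by
    intro x hx
    obtain ⟨y, hy, rfl⟩ := Multiset.mem_map.1 hx
    have := hle y hy
    have := sq_nonneg ‖h y‖
    linarith
  have h0 : (s.map (fun z => -(2 * (v.re * (h z).re + v.im * (h z).im)))).sum = 0 := by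
    rw [Multiset.sum_map_neg, neg_eq_zero]
    exact hre
  have h1 := Multiset.single_le_sum hnn _ (Multiset.mem_map_of_mem _ hz)
  rw [h0] at h1
  have h2 := hle z hz
  have h3 : ‖h z‖ ^ 2 ≤ 0 := by linarith
  simpa using le_antisymm h3 (sq_nonneg _)

/-- Squaring gives |e|² ≤ -2 Re(aᵏ v ē) for every k. Summed over k < n, the left side grows
linearly, while the geometric sum stays bounded because a ≠ 1. -/
theorem eq_zero_of_norm_rotation_add_le {a v e : ℂ} (ha : ‖a‖ = 1) (ha1 : a ≠ 1)
    (h : ∀ k : ℕ, ‖a ^ k * v + e‖ ≤ ‖v‖) : e = 0 := by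
  by_contra he
  have hk : ∀ k : ℕ, ‖e‖ ^ 2 ≤ -2 * (a ^ k * (v * (starRingEnd ℂ) e)).re := by
    intro k
    have h1 := pow_le_pow_left₀ (norm_nonneg _) (h k) 2
    rw [Complex.sq_norm, Complex.normSq_add, ← Complex.sq_norm, ← Complex.sq_norm, norm_mul,
      norm_pow, ha, one_pow, one_mul] at h1
    rw [mul_assoc] at h1
    linarith
  have hsum : ∀ n : ℕ, n * ‖e‖ ^ 2 ≤ 2 * (2 / ‖a - 1‖ * ‖v * (starRingEnd ℂ) e‖) := by
    intro n
    have h1 : n * ‖e‖ ^ 2 ≤ ∑ k ∈ Finset.range n, -2 * (a ^ k * (v * (starRingEnd ℂ) e)).re := by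
      have := Finset.card_nsmul_le_sum (Finset.range n) _ _ (fun k _ => hk k)
      simpa using this
    refine h1.trans ?_
    rw [← Finset.mul_sum, ← Complex.re_sum, ← Finset.sum_mul, geom_sum_eq ha1]
    have h2 : ‖(a ^ n - 1) / (a - 1) * (v * (starRingEnd ℂ) e)‖ ≤
        2 / ‖a - 1‖ * ‖v * (starRingEnd ℂ) e‖ := by
      rw [norm_mul, norm_div]
      gcongr
      refine (norm_sub_le _ _).trans ?_
      rw [norm_pow, ha]; norm_num
    have h3 := (Complex.abs_re_le_norm _).trans h2
    have h4 := neg_abs_le ((a ^ n - 1) / (a - 1) * (v * (starRingEnd ℂ) e)).re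
    linarith
  have hpos : 0 < ‖e‖ ^ 2 := by positivity
  obtain ⟨n, hn⟩ := exists_nat_gt (2 * (2 / ‖a - 1‖ * ‖v * (starRingEnd ℂ) e‖) / ‖e‖ ^ 2)
  rw [div_lt_iff₀ hpos] at hn
  exact absurd (hsum n) (not_le.2 hn)

/-! ### Rigidity of symmetries of an invariant compact set -/

theorem Polynomial.coeff_comp_affine_pred {p : ℂ[X]} (hp : p.Monic) (hd : 2 ≤ p.natDegree)
    (hcen : p.coeff (p.natDegree - 1) = 0) (a b : ℂ) :
    (p.comp (C a * X + C b)).coeff (p.natDegree - 1) =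
      p.natDegree * a ^ (p.natDegree - 1) * b := by
  have hcomp : p.comp (C a * X + C b) = (taylor b p).comp (C a * X) := by
    rw [taylor_apply, comp_assoc]
    simp
  have hdeg : (hasseDeriv (p.natDegree - 1) p).natDegree < 2 :=
    (natDegree_hasseDeriv_le p _).trans_lt (by omega)
  rw [hcomp, comp_C_mul_X_coeff, taylor_coeff, eval_eq_sum_range' hdeg, Finset.sum_range_succ,
    Finset.sum_range_one, hasseDeriv_coeff, hasseDeriv_coeff, zero_add, hcen,
    show 1 + (p.natDegree - 1) = p.natDegree by omega, hp.coeff_natDegree,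
    Nat.choose_symm_of_eq_add (show p.natDegree = (p.natDegree - 1) + 1 by omega),
    Nat.choose_one_right]
  ring

/-- A compact completely invariant set of a normalized polynomial that is preserved by a rigid
motion forces the motion to be a rotation about the origin that semi-conjugates the polynomial. -/
theorem rotation_of_invariant {p : ℂ[X]} (hp : p.Monic) (hd : 2 ≤ p.natDegree)
    (hcen : p.coeff (p.natDegree - 1) = 0) {J : Set ℂ} (hJc : IsCompact J) (hJn : J.Nonempty)
    (hJ : ∀ z, p.eval z ∈ J ↔ z ∈ J) {a b : ℂ} (ha : ‖a‖ = 1) (hs : ∀ z ∈ J, a * z + b ∈ J) :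
    b = 0 ∧ p.comp (C a * X) = C (a ^ p.natDegree) * p := by
  have ha0 : a ≠ 0 := by rintro rfl; simp at ha
  have hd0 : 0 < p.natDegree := by omega
  rcases eq_or_ne a 1 with rfl | ha1
  · refine ⟨?_, by simp⟩
    obtain ⟨z, hz⟩ := hJn
    have hn : ∀ n : ℕ, z + n * b ∈ J := by
      intro n
      induction n with
      | zero => simpa using hz
      | succ n ih => have := hs _ ih; push_cast; convert this using 1; ring
    by_contra hb
    obtain ⟨R, hR⟩ := hJc.isBounded.exists_norm_le
    obtain ⟨n, hn'⟩ := exists_nat_gt ((R + ‖z‖) / ‖b‖)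
    rw [div_lt_iff₀ (norm_pos_iff.2 hb)] at hn'
    have h1 := hR _ (hn n)
    have h2 := norm_sub_le (z + n * b) z
    rw [add_sub_cancel_left, norm_mul, Complex.norm_natCast] at h2
    linarith
  set c : ℂ := b / (1 - a) with hcdef
  have hca : a * c + b = c := by
    have : (1 : ℂ) - a ≠ 0 := sub_ne_zero.2 ha1.symm
    rw [hcdef]; field_simp; ring
  have hfib : ∀ w z, z ∈ (p - C w).roots ↔ p.eval z = w := by
    intro w z
    rw [mem_roots (hp.sub_C_of_natDegree_pos hd0 w).ne_zero]
    simp [sub_eq_zero]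
  obtain ⟨w₀, hw₀, hmax⟩ := hJc.exists_isMaxOn hJn
    (f := fun w => ‖w - c‖) (by fun_prop)
  have hmax' : ∀ w ∈ J, ‖w - c‖ ≤ ‖w₀ - c‖ := fun w hw => hmax hw
  by_cases hwc : w₀ = c
  · -- the invariant set is the single point `c`
    have hJs : ∀ z ∈ J, z = c := by
      intro z hz
      have := hmax' z hz
      rw [hwc, sub_self, norm_zero] at this
      exact sub_eq_zero.1 (norm_le_zero_iff.1 this)
    -- By complete invariance the whole fibre above c lies in `J`, hence equals c.
    have hroots : (p - C c).roots = Multiset.replicate p.natDegree c := by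
      rw [Multiset.eq_replicate]
      refine ⟨card_fibre p c, fun z hz => hJs z ?_⟩
      rw [hfib] at hz
      rw [← hJ, hz, ← hwc]; exact hw₀
    have hpe : p - C c = (X - C c) ^ p.natDegree := by
      have := (IsAlgClosed.splits (p - C c)).eq_prod_roots_of_monic
        (hp.sub_C_of_natDegree_pos hd0 c)
      rw [hroots] at this
      simpa using this
    have hc0 : c = 0 := by
      have h1 := congrArg (fun q => coeff q (p.natDegree - 1)) hpe
      simp only [coeff_sub, hcen, coeff_C, if_neg (show p.natDegree - 1 ≠ 0 by omega)] at h1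
      rw [sub_eq_add_neg X, ← C_neg, coeff_X_add_C_pow,
        show p.natDegree - (p.natDegree - 1) = 1 by omega,
        Nat.choose_symm_of_eq_add (show p.natDegree = (p.natDegree - 1) + 1 by omega),
        Nat.choose_one_right] at h1
      have : (p.natDegree : ℂ) ≠ 0 := by exact_mod_cast hd0.ne'
      simpa [this] using h1
    rw [hc0] at hca hpe
    refine ⟨by simpa using hca, ?_⟩
    simp only [C_0, sub_zero] at hpe
    conv_lhs => rw [hpe]
    conv_rhs => rw [C_pow]; rhs; rw [hpe]
    simp [mul_pow]
  set d := p.natDegree with hddef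
  set v := w₀ - c with hv
  have had : a ^ d ≠ 0 := pow_ne_zero _ ha0
  -- The factor a⁻ᵈ has modulus 1 and makes the leading terms cancel.
  set h : ℂ[X] := C ((a ^ d)⁻¹) * (p.comp (C a * X + C b) - C c) - (p - C c) with hh
  have hlin : (C a * X + C b).natDegree = 1 := natDegree_linear ha0
  have hqd : (p.comp (C a * X + C b)).natDegree = d := by rw [natDegree_comp, hlin, mul_one]
  have hql : (p.comp (C a * X + C b)).coeff d = a ^ d := by
    have := leadingCoeff_comp (p := p) (q := C a * X + C b) (by rw [hlin]; exact one_ne_zero)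
    rw [leadingCoeff, hqd, hp.leadingCoeff, leadingCoeff_linear ha0, one_mul] at this
    exact this
  have hhd : h.natDegree < d := by
    have hle : h.natDegree ≤ d := by
      refine (natDegree_sub_le _ _).trans (max_le ?_ ?_)
      · refine (natDegree_C_mul_le _ _).trans ?_
        rw [natDegree_sub_C, hqd]
      · rw [natDegree_sub_C]
    refine lt_of_le_of_ne hle fun he => ?_
    have h0 : h.coeff d = 0 := by
      simp only [hh, coeff_sub, coeff_C_mul, coeff_C, if_neg hd0.ne', hql, sub_zero]
      rw [inv_mul_cancel₀ had, hddef, hp.coeff_natDegree, sub_self]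
    rw [← he, coeff_natDegree, leadingCoeff_eq_zero] at h0
    rw [h0] at he
    simp at he
    omega
  have hheval : ∀ z, (p.eval z - c) + h.eval z = (a ^ d)⁻¹ * (p.eval (a * z + b) - c) := by
    intro z
    simp only [hh, eval_sub, eval_mul, eval_C, eval_comp, eval_add, eval_X]
    ring
  have hbound : ∀ z ∈ J, ‖(p.eval z - c) + h.eval z‖ ≤ ‖v‖ := by
    intro z hz
    rw [hheval, norm_mul, norm_inv, norm_pow, ha, one_pow, inv_one, one_mul]
    exact hmax' _ ((hJ _).2 (hs z hz))
  have hrot : ∀ k : ℕ, c + a ^ k * v ∈ J := by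
    intro k
    induction k with
    | zero => simpa [hv] using hw₀
    | succ k ih =>
      have := hs _ ih
      convert this using 1
      linear_combination (-1 : ℂ) * hca
  have hsum0 : ∀ w, ((p - C w).roots.map h.eval).sum = 0 := by
    intro w'
    set t := ((p - C w').roots.map h.eval).sum with ht
    have hdc : (d : ℂ) ≠ 0 := by exact_mod_cast hd0.ne'
    have : t / d = 0 := by
      -- `t / d` is the mean of h over any fibre; above c + aᵏv, the mean of p - c + h is aᵏv + t/d,
      -- and each summand has modulus at most |v|.
      refine eq_zero_of_norm_rotation_add_le (v := v) ha ha1 fun k => ?_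
      have hwJ := hrot k
      set w := c + a ^ k * v with hw
      have hsumw : ((p - C w).roots.map fun z => (w - c) + h.eval z).sum = d * (w - c) + t := by
        rw [Multiset.sum_map_add, sum_fibre_eq hp hhd w w']
        simp [card_fibre, ht, hddef]
      have hnorm : ‖(d : ℂ) * (w - c) + t‖ ≤ d * ‖v‖ := by
        rw [← hsumw]
        refine (norm_multiset_sum_le _).trans ?_
        rw [Multiset.map_map]
        have := Multiset.sum_le_card_nsmul
          ((p - C w).roots.map (norm ∘ fun z => (w - c) + h.eval z)) ‖v‖ (by
            intro x hx
            obtain ⟨z, hz, rfl⟩ := Multiset.mem_map.1 hx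
            rw [hfib] at hz
            have := hbound z ((hJ z).1 (by rw [hz]; exact hwJ))
            rw [hz] at this
            exact this)
        simpa [card_fibre] using this
      have h1 : a ^ k * v + t / d = (d * (w - c) + t) / d := by
        rw [hw]; field_simp; ring
      rw [h1, norm_div, Complex.norm_natCast, div_le_iff₀ (by exact_mod_cast hd0)]
      linarith
    simpa [hdc] using this
  have hvan : ∀ w ∈ J, ‖w - c‖ = ‖v‖ → ∀ z, p.eval z = w → h.eval z = 0 := by
    intro w hw hwv z hz
    refine eq_zero_of_norm_add_le_of_sum_eq_zero (p - C w).roots h.eval (w - c) (hsum0 w) ?_ z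
      ((hfib w z).2 hz)
    intro y hy
    rw [hfib] at hy
    have := hbound y ((hJ y).1 (by rw [hy]; exact hw))
    rw [hy] at this
    rwa [hwv]
  have hv0 : v ≠ 0 := sub_ne_zero.2 hwc
  have hh0 : h = 0 := by
    -- The points `w₀` and σ(w₀) are both extremal, and distinct since a ≠ 1 and v ≠ 0.
    refine eq_zero_of_two_fibres hhd (w₁ := c + a ^ 0 * v) (w₂ := c + a ^ 1 * v) ?_
      (hvan _ (hrot 0) (by simp)) (hvan _ (hrot 1) (by simp [ha]))
    intro he
    simp only [pow_zero, pow_one, one_mul, add_right_inj] at he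
    exact ha1 (mul_right_cancel₀ hv0 (by rw [one_mul]; exact he.symm))
  have hfun : p.comp (C a * X + C b) - C c = C (a ^ d) * (p - C c) := by
    have h1 := sub_eq_zero.1 (hh ▸ hh0)
    rw [← h1, ← mul_assoc, ← C_mul, mul_inv_cancel₀ had, C_1, one_mul]
  have hb : b = 0 := by
    have h1 := congrArg (fun q => coeff q (d - 1)) hfun
    simp only [coeff_sub, coeff_C_mul, coeff_C, if_neg (show d - 1 ≠ 0 by omega), hcen,
      sub_zero, mul_zero] at h1
    rw [hddef, coeff_comp_affine_pred hp hd hcen] at h1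
    have hdc : (p.natDegree : ℂ) ≠ 0 := by exact_mod_cast hd0.ne'
    simpa [hdc, ha0] using h1
  refine ⟨hb, ?_⟩
  have hc0 : c = 0 := by rw [hcdef, hb, zero_div]
  rw [hc0, hb] at hfun
  simpa using hfun

/-! ### The Julia set of a polynomial in the finite plane -/

@[simp] theorem ratMap_polyRat_coe (p : ℂ[X]) (z : ℂ) :
    ratMap (polyRat p) (z : OnePoint ℂ) = ((p.eval z : ℂ) : OnePoint ℂ) := by
  change (if (polyRat p).denom.eval z = 0 then OnePoint.infty else _) = _
  simp [polyRat, RatFunc.num_algebraMap, RatFunc.denom_algebraMap]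

theorem iterate_ratMap_polyRat_coe (p : ℂ[X]) (n : ℕ) (z : ℂ) :
    (ratMap (polyRat p))^[n] (z : OnePoint ℂ) = (((p.eval ·)^[n] z : ℂ) : OnePoint ℂ) := by
  induction n generalizing z with
  | zero => rfl
  | succ n ih => rw [Function.iterate_succ_apply, ratMap_polyRat_coe, ih]; rfl

theorem chordalDist_coe (z w : ℂ) : chordalDist (z : OnePoint ℂ) (w : OnePoint ℂ) =
    2 * ‖z - w‖ / (√(1 + ‖z‖ ^ 2) * √(1 + ‖w‖ ^ 2)) := rfl

theorem one_le_sqrt_one_add_sq (x : ℝ) : 1 ≤ √(1 + x ^ 2) :=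
  Real.one_le_sqrt.2 (by nlinarith [sq_nonneg x])

theorem le_sqrt_one_add_sq (x : ℝ) : x ≤ √(1 + x ^ 2) :=
  Real.le_sqrt_of_sq_le (by linarith)

theorem chordalDist_coe_le (z w : ℂ) :
    chordalDist (z : OnePoint ℂ) (w : OnePoint ℂ) ≤ 2 * ‖z - w‖ := by
  rw [chordalDist_coe]
  refine div_le_self (by positivity) ?_
  nlinarith [one_le_sqrt_one_add_sq ‖z‖, one_le_sqrt_one_add_sq ‖w‖]

theorem chordalDist_coe_le_of_le_norm {M : ℝ} (hM : 0 < M) {z w : ℂ} (hz : M ≤ ‖z‖)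
    (hw : M ≤ ‖w‖) : chordalDist (z : OnePoint ℂ) (w : OnePoint ℂ) ≤ 4 / M := by
  rw [chordalDist_coe]
  have h1 := hz.trans (le_sqrt_one_add_sq ‖z‖)
  have h2 := hw.trans (le_sqrt_one_add_sq ‖w‖)
  rw [div_le_div_iff₀ (by positivity) hM]
  have h3 := norm_sub_le z w
  have h4 := le_sqrt_one_add_sq ‖z‖
  have h5 := le_sqrt_one_add_sq ‖w‖
  set A := √(1 + ‖z‖ ^ 2)
  set B := √(1 + ‖w‖ ^ 2)
  have : ‖z - w‖ * M ≤ A * M + B * M := by nlinarith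
  nlinarith [mul_nonneg (sub_nonneg.2 h1) (hM.le.trans h2), mul_nonneg (sub_nonneg.2 h2) (hM.le.trans h1)]

theorem le_chordalDist_of_far {r : ℝ} (hr : 1 ≤ r) {z w : ℂ} (hz : 2 * r ≤ ‖z‖) (hw : ‖w‖ ≤ r) :
    1 / (2 * √(1 + r ^ 2)) ≤ chordalDist (z : OnePoint ℂ) (w : OnePoint ℂ) := by
  rw [chordalDist_coe]
  have h1 : ‖z‖ / 2 ≤ ‖z - w‖ := by
    have := norm_sub_norm_le z w
    linarith
  have h2 : √(1 + ‖z‖ ^ 2) ≤ 2 * ‖z‖ := by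
    rw [Real.sqrt_le_left (by positivity)]
    nlinarith
  have h3 : √(1 + ‖w‖ ^ 2) ≤ √(1 + r ^ 2) := Real.sqrt_le_sqrt (by gcongr)
  rw [div_le_div_iff₀ (by positivity) (by positivity)]
  have h4 : √(1 + ‖z‖ ^ 2) * √(1 + ‖w‖ ^ 2) ≤ 2 * ‖z‖ * √(1 + r ^ 2) := by gcongr
  have h5 : 0 ≤ √(1 + r ^ 2) := Real.sqrt_nonneg _
  nlinarith

/-- Outside a large disc a polynomial of degree at least two doubles the modulus. -/
theorem Polynomial.exists_two_mul_norm_le {p : ℂ[X]} (hd : 2 ≤ p.natDegree) :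
    ∃ r : ℝ, 1 ≤ r ∧ ∀ z : ℂ, r ≤ ‖z‖ → 2 * ‖z‖ ≤ ‖p.eval z‖ := by
  have hdeg : 0 < p.divX.degree := by
    rw [← natDegree_pos_iff_degree_pos, natDegree_divX_eq_natDegree_tsub_one]; omega
  have ht := p.divX.tendsto_norm_atTop hdeg (tendsto_norm_cobounded_atTop (E := ℂ))
  have he := ht.eventually_ge_atTop 3
  obtain ⟨r, -, hr⟩ := (Metric.hasBasis_cobounded_compl_closedBall (0 : ℂ)).eventually_iff.1 he
  -- Write p(z) = q(z)z + p(0): with |q(z)| ≥ 3 and |p(0)| ≤ |z|, the factor 2 remains.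
  refine ⟨max 1 (max (r + 1) ‖p.coeff 0‖), le_max_left _ _, fun z hz => ?_⟩
  have h1 : r + 1 ≤ ‖z‖ := ((le_max_left _ _).trans (le_max_right _ _)).trans hz
  have h2 : ‖p.coeff 0‖ ≤ ‖z‖ := ((le_max_right _ _).trans (le_max_right _ _)).trans hz
  have h3 : 3 ≤ ‖p.divX.eval z‖ := hr (by simp; linarith)
  have h4 : p.eval z = p.divX.eval z * z + p.coeff 0 := by
    conv_lhs => rw [← divX_mul_X_add p]
    simp
  rw [h4]
  have h5 := norm_sub_le (p.divX.eval z * z + p.coeff 0) (p.coeff 0)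
  rw [add_sub_cancel_right, norm_mul] at h5
  nlinarith [norm_nonneg z]

theorem Polynomial.two_pow_mul_norm_le_iterate {p : ℂ[X]} {r : ℝ} (hr : 0 ≤ r)
    (h : ∀ z : ℂ, r ≤ ‖z‖ → 2 * ‖z‖ ≤ ‖p.eval z‖) {z : ℂ} (hz : r ≤ ‖z‖) (n : ℕ) :
    2 ^ n * ‖z‖ ≤ ‖(p.eval ·)^[n] z‖ := by
  induction n generalizing z with
  | zero => simp
  | succ n ih =>
    have h1 := h z hz
    have h2 := ih (z := p.eval z) (by linarith)
    rw [Function.iterate_succ_apply]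
    refine le_trans ?_ h2
    rw [pow_succ, mul_assoc]
    gcongr

/-- This is continuity together with the open mapping theorem. The equality of filters moves local
statements between z and p(z) in both directions, which yields complete invariance. -/
theorem Polynomial.map_eval_nhds {p : ℂ[X]} (hd : 0 < p.natDegree) (z : ℂ) :
    Filter.map (p.eval ·) (𝓝 z) = 𝓝 (p.eval z) := by
  refine le_antisymm p.continuous.continuousAt ?_
  have han : AnalyticAt ℂ (p.eval ·) z :=
    (p.differentiable.differentiableOn.analyticOnNhd isOpen_univ) z trivial
  refine han.eventually_constant_or_nhds_le_map_nhds.resolve_left fun hc => ?_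
  have hfin : {w : ℂ | p.eval w = p.eval z}.Finite := by
    refine ((p - C (p.eval z)).roots.toFinset.finite_toSet).subset fun w hw => ?_
    have hne : p - C (p.eval z) ≠ 0 := fun e => by
      have := natDegree_sub_C (p := p) (a := p.eval z)
      rw [e] at this; simp at this; omega
    simpa [hne, sub_eq_zero] using hw
  have h1 : {w : ℂ | p.eval w = p.eval z} ∈ 𝓝 z := hc
  exact (infinite_of_mem_nhds z h1) hfin

theorem mem_fatouSet_iff {f : OnePoint ℂ → OnePoint ℂ} {z : OnePoint ℂ} :
    z ∈ fatouSet f ↔ ∀ᶠ w in 𝓝 z, IteratesEquicontinuousAt f w := by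
  rw [eventually_nhds_iff]
  constructor
  · rintro ⟨U, ⟨hU, hE⟩, hz⟩
    exact ⟨U, hE, hU, hz⟩
  · rintro ⟨U, hE, hU, hz⟩
    exact ⟨U, ⟨hU, hE⟩, hz⟩

theorem isOpen_fatouSet (f : OnePoint ℂ → OnePoint ℂ) : IsOpen (fatouSet f) :=
  isOpen_sUnion fun _ h => h.1

theorem iteratesEquicontinuousAt_polyRat_coe_iff {p : ℂ[X]} {z : ℂ} :
    IteratesEquicontinuousAt (ratMap (polyRat p)) (z : OnePoint ℂ) ↔
      ∀ ε : ℝ, 0 < ε → ∀ᶠ w in 𝓝 z, ∀ n : ℕ, 0 < n →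
        chordalDist (((p.eval ·)^[n] w : ℂ) : OnePoint ℂ) (((p.eval ·)^[n] z : ℂ) : OnePoint ℂ)
          < ε := by
  simp only [IteratesEquicontinuousAt, OnePoint.nhds_coe_eq, Filter.eventually_map,
    iterate_ratMap_polyRat_coe]

theorem iteratesEquicontinuousAt_polyRat_eval_iff {p : ℂ[X]} (hd : 0 < p.natDegree) {z : ℂ} :
    IteratesEquicontinuousAt (ratMap (polyRat p)) ((p.eval z : ℂ) : OnePoint ℂ) ↔
      IteratesEquicontinuousAt (ratMap (polyRat p)) (z : OnePoint ℂ) := by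
  rw [iteratesEquicontinuousAt_polyRat_coe_iff, iteratesEquicontinuousAt_polyRat_coe_iff]
  simp only [← map_eval_nhds hd, Filter.eventually_map, ← Function.iterate_succ_apply (p.eval ·)]
  refine forall₂_congr fun ε hε => ⟨fun h => ?_, fun h => ?_⟩
  -- Equicontinuity at p(z) controls the iterates from the second on; the first needs continuity of
  -- p.
  · have hc : ∀ᶠ w in 𝓝 z, 2 * ‖p.eval w - p.eval z‖ < ε := by
      have : Filter.Tendsto (fun w => 2 * ‖p.eval w - p.eval z‖) (𝓝 z)
          (𝓝 (2 * ‖p.eval z - p.eval z‖)) := by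
        apply Continuous.tendsto; fun_prop
      rw [sub_self, norm_zero, mul_zero] at this
      exact this.eventually_lt_const hε
    filter_upwards [h, hc] with w hw hw' n hn
    obtain ⟨m, rfl⟩ := Nat.exists_eq_succ_of_ne_zero hn.ne'
    rcases Nat.eq_zero_or_pos m with rfl | hm
    · exact (chordalDist_coe_le _ _).trans_lt hw'
    · exact hw m hm
  · filter_upwards [h] with w hw n hn
    exact hw (n + 1) n.succ_pos

theorem eval_mem_fatouSet_iff {p : ℂ[X]} (hd : 0 < p.natDegree) {z : ℂ} :
    ((p.eval z : ℂ) : OnePoint ℂ) ∈ fatouSet (ratMap (polyRat p)) ↔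
      (z : OnePoint ℂ) ∈ fatouSet (ratMap (polyRat p)) := by
  simp only [mem_fatouSet_iff, OnePoint.nhds_coe_eq, ← map_eval_nhds hd, Filter.eventually_map,
    iteratesEquicontinuousAt_polyRat_eval_iff hd]

theorem iteratesEquicontinuousAt_polyRat_of_lt_norm {p : ℂ[X]} {r : ℝ} (hr : 1 ≤ r)
    (h : ∀ z : ℂ, r ≤ ‖z‖ → 2 * ‖z‖ ≤ ‖p.eval z‖) {z : ℂ} (hz : r < ‖z‖) :
    IteratesEquicontinuousAt (ratMap (polyRat p)) (z : OnePoint ℂ) := by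
  rw [iteratesEquicontinuousAt_polyRat_coe_iff]
  intro ε hε
  -- From the N-th iterate on, both orbits have modulus at least 2ᴺ > 4/ε, so they are chordally
  -- close near infinity; the earlier iterates are finitely many.
  obtain ⟨N, hN⟩ := pow_unbounded_of_one_lt (4 / ε) (one_lt_two (α := ℝ))
  have hnear : ∀ᶠ w in 𝓝 z, r < ‖w‖ :=
    continuous_norm.continuousAt.eventually (lt_mem_nhds hz)
  have hfin : ∀ᶠ w in 𝓝 z, ∀ n ∈ Finset.range N,
      2 * ‖(p.eval ·)^[n] w - (p.eval ·)^[n] z‖ < ε := by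
    rw [Filter.eventually_all_finset]
    intro n _
    have hcont : Continuous ((p.eval ·)^[n] : ℂ → ℂ) := p.continuous.iterate n
    have : Filter.Tendsto (fun w => 2 * ‖(p.eval ·)^[n] w - (p.eval ·)^[n] z‖) (𝓝 z)
        (𝓝 (2 * ‖(p.eval ·)^[n] z - (p.eval ·)^[n] z‖)) := by
      apply Continuous.tendsto; fun_prop
    rw [sub_self, norm_zero, mul_zero] at this
    exact this.eventually_lt_const hε
  filter_upwards [hnear, hfin] with w hw hw' n _
  rcases lt_or_ge n N with hn | hn
  · exact (chordalDist_coe_le _ _).trans_lt (hw' n (Finset.mem_range.2 hn))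
  · have hbig : ∀ y : ℂ, r < ‖y‖ → (2 : ℝ) ^ N ≤ ‖(p.eval ·)^[n] y‖ := by
      intro y hy
      refine le_trans ?_ (two_pow_mul_norm_le_iterate (by linarith) h hy.le n)
      have : (2 : ℝ) ^ N ≤ 2 ^ n := pow_le_pow_right₀ one_le_two hn
      nlinarith [pow_pos (two_pos (α := ℝ)) n]
    refine (chordalDist_coe_le_of_le_norm (by positivity) (hbig w hw) (hbig z hz)).trans_lt ?_
    rw [div_lt_iff₀ (by positivity)]
    rwa [div_lt_iff₀ hε, mul_comm] at hN

theorem isCompact_finite_juliaSet_polyRat {p : ℂ[X]} (hd : 2 ≤ p.natDegree) :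
    IsCompact {z : ℂ | (z : OnePoint ℂ) ∈ juliaSet (ratMap (polyRat p))} := by
  obtain ⟨r, hr, h⟩ := exists_two_mul_norm_le hd
  refine Metric.isCompact_of_isClosed_isBounded ?_ ?_
  · exact ((isOpen_fatouSet _).preimage OnePoint.continuous_coe).isClosed_compl
  · refine (Metric.isBounded_closedBall (x := (0 : ℂ)) (r := r)).subset fun z hz => ?_
    rw [mem_closedBall_zero_iff]
    by_contra! hlt
    refine hz (mem_fatouSet_iff.2 ?_)
    rw [OnePoint.nhds_coe_eq, Filter.eventually_map]
    filter_upwards [continuous_norm.continuousAt.eventually (lt_mem_nhds hlt)] with w hw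
    exact iteratesEquicontinuousAt_polyRat_of_lt_norm hr h hw

/-- The set `K` of points whose orbits stay in the disc of radius r contains a fixed point of p and
is not the whole plane, so it has a frontier point. Arbitrarily close to that point are escaping
orbits, which rules out equicontinuity there. -/
theorem finite_juliaSet_polyRat_nonempty {p : ℂ[X]} (hd : 2 ≤ p.natDegree) :
    {z : ℂ | (z : OnePoint ℂ) ∈ juliaSet (ratMap (polyRat p))}.Nonempty := by
  obtain ⟨r, hr, h⟩ := exists_two_mul_norm_le hd
  set K : Set ℂ := {z | ∀ n : ℕ, ‖(p.eval ·)^[n] z‖ ≤ r} with hK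
  have hKc : IsClosed K := by
    rw [hK, Set.ofPred_forall]
    refine isClosed_iInter fun n => isClosed_le ?_ continuous_const
    exact (p.continuous.iterate n).norm
  have hKn : K.Nonempty := by
    have hdeg : (p - X).natDegree = p.natDegree :=
      natDegree_sub_eq_left_of_natDegree_lt (by rw [natDegree_X]; omega)
    obtain ⟨x, hx⟩ := IsAlgClosed.exists_root (p - X) 
      (degree_ne_of_natDegree_ne (n := 0) (by rw [hdeg]; omega))
    have hx' : p.eval x = x := by simpa [sub_eq_zero] using hx
    refine ⟨x, fun n => ?_⟩
    rw [Function.iterate_fixed hx']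
    by_contra! hlt
    have := h x hlt.le
    rw [hx'] at this
    linarith
  have hKu : K ≠ Set.univ := by
    intro he
    have h1 : ((r + 1 : ℝ) : ℂ) ∈ K := he ▸ Set.mem_univ _
    have h2 := h1 0
    rw [Function.iterate_zero, id, Complex.norm_real, Real.norm_eq_abs,
      abs_of_nonneg (by linarith)] at h2
    linarith
  obtain ⟨z, hz⟩ := nonempty_frontier_iff.2 ⟨hKn, hKu⟩
  refine ⟨z, fun hF => ?_⟩
  have hzK : z ∈ K := hKc.frontier_subset hz
  have hE := iteratesEquicontinuousAt_polyRat_coe_iff.1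
    ((mem_fatouSet_iff.1 hF).self_of_nhds) (1 / (2 * √(1 + r ^ 2))) (by positivity)
  have hzc : z ∈ closure Kᶜ := by
    rw [frontier_eq_closure_inter_closure] at hz; exact hz.2
  obtain ⟨w, hw, hwK⟩ := (mem_closure_iff_frequently.1 hzc).and_eventually hE |>.exists
  simp only [hK, Set.mem_compl_iff, Set.mem_ofPred_eq, not_forall, not_le] at hw
  obtain ⟨m, hm⟩ := hw
  -- One further iterate takes the modulus from above r to above 2r and makes the index positive.
  have h1 := two_pow_mul_norm_le_iterate (by linarith) h hm.le 1
  rw [← Function.iterate_add_apply, pow_one] at h1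
  have h2 := hwK (1 + m) (by omega)
  exact absurd (le_chordalDist_of_far hr (by linarith) (hzK (1 + m))) (not_le.2 h2)

/-! ### Rotations of the sphere and maps commuting with them -/

theorem affineSphere_coe (a b z : ℂ) :
    affineSphere a b (z : OnePoint ℂ) = ((a * z + b : ℂ) : OnePoint ℂ) := rfl

theorem affineSphere_infty (a b : ℂ) : affineSphere a b OnePoint.infty = OnePoint.infty := rfl

theorem chordalDist_rotation {a : ℂ} (ha : ‖a‖ = 1) (z w : OnePoint ℂ) :
    chordalDist (affineSphere a 0 z) (affineSphere a 0 w) = chordalDist z w := by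
  induction z using OnePoint.rec <;> induction w using OnePoint.rec <;>
    simp [affineSphere_coe, affineSphere_infty, chordalDist, ← mul_sub, ha]

/-- A rotation about the origin, as a self-homeomorphism of the extended plane. -/
noncomputable def rotationHomeo {a : ℂ} (ha : a ≠ 0) : OnePoint ℂ ≃ₜ OnePoint ℂ :=
  (Homeomorph.mulLeft₀ a ha).onePointCongr

theorem coe_rotationHomeo {a : ℂ} (ha : a ≠ 0) :
    (rotationHomeo ha : OnePoint ℂ → OnePoint ℂ) = affineSphere a 0 := by
  funext z
  induction z using OnePoint.rec
  · rfl
  · rw [affineSphere_coe, add_zero]; rfl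

theorem map_affineSphere_nhds {a : ℂ} (ha : a ≠ 0) (z : OnePoint ℂ) :
    Filter.map (affineSphere a 0) (𝓝 z) = 𝓝 (affineSphere a 0 z) := by
  rw [← coe_rotationHomeo ha]; exact (rotationHomeo ha).map_nhds_eq z

theorem image_juliaSet_of_commute {f : OnePoint ℂ → OnePoint ℂ} {a : ℂ} (ha : ‖a‖ = 1)
    (hf : f ∘ affineSphere a 0 = affineSphere a 0 ∘ f) :
    affineSphere a 0 '' juliaSet f = juliaSet f := by
  have ha0 : a ≠ 0 := by rintro rfl; simp at ha
  have hcomm : ∀ n z, f^[n] (affineSphere a 0 z) = affineSphere a 0 (f^[n] z) := fun n =>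
    (Function.Commute.iterate_left (show Function.Commute f (affineSphere a 0) from congrFun hf) n)
  have hE : ∀ z, IteratesEquicontinuousAt f (affineSphere a 0 z) ↔ IteratesEquicontinuousAt f z := by
    intro z
    simp only [IteratesEquicontinuousAt, ← map_affineSphere_nhds ha0, Filter.eventually_map, hcomm,
      chordalDist_rotation ha]
  have hF : ∀ z, affineSphere a 0 z ∈ fatouSet f ↔ z ∈ fatouSet f := by
    intro z
    simp only [mem_fatouSet_iff, ← map_affineSphere_nhds ha0, Filter.eventually_map, hE]
  ext z
  obtain ⟨y, rfl⟩ : ∃ y, affineSphere a 0 y = z := by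
    rw [← coe_rotationHomeo ha0]; exact (rotationHomeo ha0).surjective z
  have hinj : Function.Injective (affineSphere a 0) := by
    rw [← coe_rotationHomeo ha0]; exact (rotationHomeo ha0).injective
  rw [hinj.mem_set_image, juliaSet, Set.mem_compl_iff, Set.mem_compl_iff, hF]

/-- `N / D` need not be in lowest terms. The relation passes to the reduced fraction n/m, where
coprimality gives m ∣ m(cX); equal degrees then make m(cX) and n(cX) scalar multiples of m and n. -/
theorem ratMap_commute_rotation {R : RatFunc ℂ} {N D : ℂ[X]} (hD : D ≠ 0)
    (hR : R = algebraMap ℂ[X] (RatFunc ℂ) N / algebraMap ℂ[X] (RatFunc ℂ) D) {c : ℂ} (hc : c ≠ 0)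
    (h : N.comp (C c * X) * D = C c * (N * D.comp (C c * X))) :
    ratMap R ∘ affineSphere c 0 = affineSphere c 0 ∘ ratMap R := by
  have hcomp0 : ∀ q : ℂ[X], q ≠ 0 → q.comp (C c * X) ≠ 0 := by
    intro q hq he
    rw [comp_eq_zero_iff] at he
    rcases he with he | ⟨-, he⟩
    · exact hq he
    · have := congrArg (fun q => coeff q 1) he
      simp [hc] at this
  set n := R.num with hn
  set m := R.denom with hm
  have hm0 : m ≠ 0 := R.denom_ne_zero
  have hnm : n * D = N * m := (RatFunc.num_mul_eq_mul_denom_iff hD).2 hR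
  have hnm' : n.comp (C c * X) * D.comp (C c * X) = N.comp (C c * X) * m.comp (C c * X) := by
    rw [← mul_comp, hnm, mul_comp]
  have hsymm : n.comp (C c * X) * m = C c * (n * m.comp (C c * X)) := by
    refine mul_right_cancel₀ (mul_ne_zero hD (hcomp0 D hD)) ?_
    linear_combination m * D * hnm' + m * m.comp (C c * X) * h
      - C c * m.comp (C c * X) * D.comp (C c * X) * hnm
  have hcop : IsCoprime n m := R.isCoprime_num_denom
  have hdvd : m ∣ m.comp (C c * X) := by
    have h1 : m ∣ n * m.comp (C c * X) := by
      have : m ∣ C c * (n * m.comp (C c * X)) := ⟨n.comp (C c * X), by rw [← hsymm, mul_comm]⟩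
      rwa [(isUnit_C.2 hc.isUnit).dvd_mul_left] at this
    exact hcop.symm.dvd_of_dvd_mul_left h1
  have hdeg : (m.comp (C c * X)).natDegree = m.natDegree := by
    rw [natDegree_comp, natDegree_C_mul_X _ hc, mul_one]
  have hlead : (m.comp (C c * X)).leadingCoeff = c ^ m.natDegree := by
    rw [leadingCoeff_comp (by rw [natDegree_C_mul_X _ hc]; exact one_ne_zero),
      R.monic_denom.leadingCoeff, leadingCoeff_C_mul_X, one_mul]
  have hmc : m.comp (C c * X) = C (c ^ m.natDegree) * m := by
    obtain ⟨u, hu⟩ := hdvd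
    have hu0 : u ≠ 0 := by rintro rfl; exact hcomp0 m hm0 (by rw [hu, mul_zero])
    have h1 := congrArg natDegree hu
    rw [hdeg, natDegree_mul hm0 hu0] at h1
    have h2 := eq_C_of_natDegree_eq_zero (show u.natDegree = 0 by omega)
    have h3 := hlead
    rw [hu, leadingCoeff_mul, R.monic_denom.leadingCoeff, one_mul, h2, leadingCoeff_C] at h3
    rw [hu, mul_comm, h2, h3]
  have hnc : n.comp (C c * X) = C (c ^ (m.natDegree + 1)) * n := by
    refine mul_right_cancel₀ hm0 ?_
    rw [hsymm, hmc, pow_succ, C_mul]; ring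
  have heval : ∀ (q : ℂ[X]) (z : ℂ), q.eval (c * z) = (q.comp (C c * X)).eval z := by
    intro q z; simp
  funext z
  induction z using OnePoint.rec with
  | infty =>
    simp only [Function.comp_apply, affineSphere_infty]
    change (if m.natDegree < n.natDegree then OnePoint.infty else _) =
      affineSphere c 0 (if m.natDegree < n.natDegree then OnePoint.infty else _)
    split_ifs with hlt
    · rfl
    · rw [affineSphere_coe, add_zero, OnePoint.coe_eq_coe]
      -- In degree `m.natDegree` this says that the finite value at infinity is fixed by
      -- multiplication by c.
      have h1 := congrArg (fun q => coeff q m.natDegree) hnc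
      simp only [comp_C_mul_X_coeff, coeff_C_mul, pow_succ] at h1
      have hcm : c ^ m.natDegree ≠ 0 := pow_ne_zero _ hc
      refine mul_right_cancel₀ hcm ?_
      linear_combination h1
  | coe z =>
    simp only [Function.comp_apply, affineSphere_coe, add_zero]
    change (if m.eval (c * z) = 0 then OnePoint.infty else
        ((n.eval (c * z) / m.eval (c * z) : ℂ) : OnePoint ℂ)) =
      affineSphere c 0 (if m.eval z = 0 then OnePoint.infty else
        ((n.eval z / m.eval z : ℂ) : OnePoint ℂ))
    have hcm : c ^ m.natDegree ≠ 0 := pow_ne_zero _ hc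
    rw [heval, heval, hmc, hnc, eval_C_mul, eval_C_mul]
    by_cases hz : m.eval z = 0
    · rw [if_pos (by rw [hz, mul_zero]), if_pos hz]; rfl
    · rw [if_neg (mul_ne_zero hcm hz), if_neg hz, affineSphere_coe, add_zero, OnePoint.coe_eq_coe]
      field_simp
      ring

/-! ### Chebyshev's method and rotations -/

theorem chebyshevMethod_eq_div {p : ℂ[X]} (hp : derivative p ≠ 0) :
    chebyshevMethod p = algebraMap ℂ[X] (RatFunc ℂ)
        (2 * X * derivative p ^ 3 - (2 * derivative p ^ 2 + p * derivative (derivative p)) * p) /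
      algebraMap ℂ[X] (RatFunc ℂ) (2 * derivative p ^ 3) := by
  have h : algebraMap ℂ[X] (RatFunc ℂ) (derivative p) ≠ 0 := by
    simpa using hp
  simp only [chebyshevMethod, chebyshevL, polyRat, map_sub, map_mul, map_add, map_pow,
    RatFunc.algebraMap_X, map_ofNat]
  field_simp

theorem chebyshevMethod_commute_rotation {p : ℂ[X]} (hp : 0 < p.natDegree) {c k : ℂ} (hc : c ≠ 0)
    (h : p.comp (C c * X) = C k * p) :
    ratMap (chebyshevMethod p) ∘ affineSphere c 0 =
      affineSphere c 0 ∘ ratMap (chebyshevMethod p) := by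
  have hd : derivative p ≠ 0 := fun e => by
    have := derivative_eq_zero.1 e; omega
  have hder : ∀ q : ℂ[X], derivative (q.comp (C c * X)) = C c * (derivative q).comp (C c * X) := by
    intro q; rw [derivative_comp]; simp
  have h1 : C c * (derivative p).comp (C c * X) = C k * derivative p := by
    rw [← hder, h, derivative_C_mul]
  have h2 : C c * (C c * (derivative (derivative p)).comp (C c * X)) =
      C k * derivative (derivative p) := by
    rw [← hder, ← derivative_C_mul, h1, derivative_C_mul]
  have hC : C c ≠ 0 := by simpa using hc
  refine ratMap_commute_rotation (by simpa using hd) (chebyshevMethod_eq_div hd) hc ?_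
  simp only [sub_comp, mul_comp, add_comp, pow_comp, X_comp, ofNat_comp, h]
  set P := (derivative p).comp (C c * X)
  set Q := (derivative (derivative p)).comp (C c * X)
  have h3 : C c ^ 2 * P ^ 2 = C k ^ 2 * derivative p ^ 2 := by rw [← mul_pow, h1, mul_pow]
  have h4 : C c ^ 3 * P ^ 3 = C k ^ 3 * derivative p ^ 3 := by rw [← mul_pow, h1, mul_pow]
  -- The factor c³ supplies the powers of c needed to replace p'(cX) and p''(cX) through `h2`, `h3`,
  -- `h4`.
  refine mul_left_cancel₀ (pow_ne_zero 3 hC) ?_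
  linear_combination (-(4 * C k * p * C c * derivative p ^ 3)) * h3
    - (2 * C k ^ 2 * p ^ 2 * C c * derivative p ^ 3) * h2
    + (2 * C c * (2 * derivative p ^ 2 + p * derivative (derivative p)) * p) * h4

theorem IsNormalizedPoly.coeff_pred {p : ℂ[X]} (hp : IsNormalizedPoly p) :
    p.coeff (p.natDegree - 1) = 0 := by
  obtain ⟨hd, hm, hc⟩ := hp
  rw [centroid, hm.leadingCoeff, mul_one, div_eq_zero_iff, neg_eq_zero] at hc
  refine hc.resolve_right ?_
  have : p.natDegree ≠ 0 := by omega
  exact_mod_cast this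

theorem mainTheorem9 (p : ℂ[X]) (hp : IsNormalizedPoly p) :
    juliaSymmetries (polyRat p) ⊆ juliaSymmetries (chebyshevMethod p) ∧
    ∀ (α β : ℕ) (p₀ : ℂ[X]), 0 < β → p = X ^ α * p₀.comp (X ^ β) →
      ∀ c : ℂ, c ^ β = 1 →
        ratMap (chebyshevMethod p) ∘ affineSphere c 0 =
          affineSphere c 0 ∘ ratMap (chebyshevMethod p) := by
  have hd : 2 ≤ p.natDegree := hp.1
  refine ⟨?_, ?_⟩
  · rintro σ ⟨a, b, ha, rfl, hσ⟩
    have ha0 : a ≠ 0 := by rintro rfl; simp at ha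
    obtain ⟨rfl, hcomp⟩ := rotation_of_invariant hp.2.1 hd hp.coeff_pred
      (isCompact_finite_juliaSet_polyRat hd) (finite_juliaSet_polyRat_nonempty hd)
      (fun z => not_congr (eval_mem_fatouSet_iff (by omega))) ha
      (fun z hz => hσ.subset (Set.mem_image_of_mem (affineSphere a b) hz))
    exact ⟨a, 0, ha, rfl, image_juliaSet_of_commute ha
      (chebyshevMethod_commute_rotation (by omega) ha0 hcomp)⟩
  · intro α β p₀ hβ hpe c hc
    have hc0 : c ≠ 0 := by rintro rfl; simp [hβ.ne'] at hc
    -- Since (cX)ᵝ = Xᵝ, only the factor Xᵅ is affected by the rotation.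
    refine chebyshevMethod_commute_rotation (k := c ^ α) (by omega) hc0 ?_
    rw [hpe, mul_comp, comp_assoc]
    simp only [pow_comp, X_comp, mul_pow, ← C_pow, hc, C_1, one_mul]
    ring
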